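/- **Setting.** There are $n+1$ processes $\Pi=\{p_0,\dots,p_n\}$ ($n\ge 0$). A vertex is a pair (process id, value), a simplex is a nonempty finite set of vertices with distinct ids, and a complex is a finite set of simplices closed under nonempty subsets. A *task* $(\mathcal I,\mathcal O,\Delta)$ consists of an input complex $\mathcal I$, an output complex $\mathcal O$, and a carrier map $\Delta$ assigning to every $s\in\mathcal I$ a subcomplex $\Delta(s)\subseteq\mathcal O$ with $\Delta(s)\subseteq\Delta(s')$ whenever $s\subseteq s'$. Protocols run in the non-uniform iterated immediate snapshot (NIIS) model: a process starts with its id and input; in each step it performs a writeread on its next immediate snapshot object with its local state as argument (a set of active processes poised to access the same object may do so concurrently: all write, then all read) and its new state is its id and the snapshot returned; then a decision map $\delta$ tells from the local state whether it terminates, and with which output. A protocol *solves* a task if for every $s\in\mathcal I$, in every configuration reached from the initial configuration $s$ (only the processes of $s$ taking steps), the outputs of the terminated processes, if there are any, form a simplex of $\Delta(s)$; it is *wait-free* if there is no infinite schedule from any initial configuration. For a simplex $U\in\mathcal I$, a *partial protocol with respect to $U$* is a decision map $\delta$ such that, when only initial configurations $s\in\mathcal I$ with $U\subseteq s$ and schedules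 whose first set of processes is $ids(U)$ are considered, there is no infinite schedule, and the outputs of the terminated processes in every reached configuration, if there are any, form a simplex of $\Delta(s)$. For a vertex $v=(p,x)$ of $\mathcal I$, let $\ell_0,\dots,\ell_m$ be the vertices with id $p$ in $\Delta(\{v\})$, and let $\mathcal O_v^i$ be the complex consisting of the $n$-simplices of $\mathcal O$ that contain $\ell_i$ and all their faces. For a complex $\mathcal K$ write $\mathcal K\setminus v$ for the complex obtained by removing all vertices with id $p$. The *link task* with index $i$ is $(lk(v,\mathcal I),\ \mathcal O_v^i\setminus v,\ \Delta_v)$, where $lk(v,\mathcal I)=\{\tau : v\notin\tau,\ \tau\cup\{v\}\in\mathcal I\}$ (with $\tau\ne\emptyset$) and $\Delta_v(\tau)$ is the part of $\Delta(\tau\cup\{v\})$ in the component $\mathcal O_v^i$ labelled $\ell_i$ (the simplices of $\Delta(\tau\cup\{v\})\cap\mathcal O_v^i$ that contain $\ell_i$, and their faces), with all vertices of id $p$ removed. **Theorem.** Let $(\mathcal I,\mathcal O,\Delta)$ be a task in which every simplex of $\mathcal I$ is a face of an $n$-simplex of $\mathcal I$. There is a partial protocol with respect to every simplex of $\mathcal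 I$ if and only if for every vertex $v$ of $\mathcal I$ there is some index $i$ such that the link task $(lk(v,\mathcal I),\mathcal O_v^i\setminus v,\Delta_v)$ has a wait-free protocol. In other words, it suffices to consider single-vertex labels: there is a partial protocol with respect to every simplex of $\mathcal I$ if and only if there is one with respect to every vertex of $\mathcal I$. -/

import Mathlib

namespace NIIS

/-! ### Coloured complexes

A vertex of a coloured complex is a pair (process, value); a simplex is a nonempty finite set of
such pairs. Complexes are Mathlib's `PreAbstractSimplicialComplex`. -/

section Complexes

variable {P X : Type*}

/-- The set of process ids of a simplex. -/
def ids [DecidableEq P] (s : Finset (P × X)) : Finset P := s.image Prod.fst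

/-- No process occurs twice in a simplex, i.e. the ids are a colouring. -/
def IsChromatic (K : PreAbstractSimplicialComplex (P × X)) : Prop :=
  ∀ s ∈ K, Set.InjOn Prod.fst (s : Set (P × X))

/-- Every simplex is a face of a simplex in which every process occurs. For a chromatic complex
over `n + 1` processes this says that all facets have dimension `n`. -/
def IsFull [Fintype P] [DecidableEq P] (K : PreAbstractSimplicialComplex (P × X)) : Prop :=
  ∀ s ∈ K, ∃ t ∈ K, s ⊆ t ∧ ids t = Finset.univ

/-- The star of `S` in `K`: the simplices of `K` that contain `S`, and their faces. -/
def starOf (S : Finset (P × X)) (K : PreAbstractSimplicialComplex (P × X)) :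
    PreAbstractSimplicialComplex (P × X) where
  faces := {s | s.Nonempty ∧ ∃ t ∈ K, S ⊆ t ∧ s ⊆ t}
  isRelLowerSet_faces := by
    rintro s ⟨hs, t, ht, hSt, hst⟩
    exact ⟨hs, fun r hr hne => ⟨hne, t, ht, hSt, hr.trans hst⟩⟩

/-- The link of `S` in `K`: the simplices of the star that share no vertex with `S`. -/
def link (S : Finset (P × X)) (K : PreAbstractSimplicialComplex (P × X)) :
    PreAbstractSimplicialComplex (P × X) where
  faces := {s | s ∈ starOf S K ∧ Disjoint s S}
  isRelLowerSet_faces := by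
    rintro s ⟨hs, hd⟩
    have h := (starOf S K).isRelLowerSet_faces hs
    exact ⟨h.1, fun r hr hne => ⟨h.2 hr hne, hd.mono_left hr⟩⟩

/-- The subcomplex of `K` of the simplices all of whose ids lie in `A`. -/
def restrictIds [DecidableEq P] (A : Finset P) (K : PreAbstractSimplicialComplex (P × X)) :
    PreAbstractSimplicialComplex (P × X) where
  faces := {s | s ∈ K ∧ ids s ⊆ A}
  isRelLowerSet_faces := by
    rintro s ⟨hs, hd⟩
    have h := K.isRelLowerSet_faces hs
    exact ⟨h.1, fun r hr hne => ⟨h.2 hr hne, (Finset.image_subset_image hr).trans hd⟩⟩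

/-- The complex obtained from `K` by removing all vertices whose id lies in `A`. -/
def removeIds [DecidableEq P] (A : Finset P) (K : PreAbstractSimplicialComplex (P × X)) :
    PreAbstractSimplicialComplex (P × X) where
  faces := {s | s ∈ K ∧ Disjoint (ids s) A}
  isRelLowerSet_faces := by
    rintro s ⟨hs, hd⟩
    have h := K.isRelLowerSet_faces hs
    exact ⟨h.1, fun r hr hne =>
      ⟨h.2 hr hne, hd.mono_left (Finset.image_subset_image hr)⟩⟩

/-- The facets of `K`. -/
def IsFacet (K : PreAbstractSimplicialComplex (P × X)) (s : Finset (P × X)) : Prop :=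
  s ∈ K ∧ ∀ t ∈ K, s ⊆ t → t = s

/-- The complex whose facets are the simplices of `K` that contain `l` and in which every process
occurs. -/
def fullStar [Fintype P] [DecidableEq P] (l : Finset (P × X)) (K : PreAbstractSimplicialComplex (P × X)) :
    PreAbstractSimplicialComplex (P × X) where
  faces := {s | s.Nonempty ∧ ∃ t ∈ K, ids t = Finset.univ ∧ l ⊆ t ∧ s ⊆ t}
  isRelLowerSet_faces := by
    rintro s ⟨hs, t, ht, hu, hlt, hst⟩
    exact ⟨hs, fun r hr hne => ⟨hne, t, ht, hu, hlt, hr.trans hst⟩⟩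

theorem starOf_le (S : Finset (P × X)) (K : PreAbstractSimplicialComplex (P × X)) :
    starOf S K ≤ K := by
  rintro s ⟨hs, t, ht, -, hst⟩
  exact (K.isRelLowerSet_faces ht).2 hst hs

theorem link_le (S : Finset (P × X)) (K : PreAbstractSimplicialComplex (P × X)) :
    link S K ≤ K := fun _ hs => starOf_le S K hs.1

theorem fullStar_le [Fintype P] [DecidableEq P] (l : Finset (P × X))
    (K : PreAbstractSimplicialComplex (P × X)) : fullStar l K ≤ K := by
  rintro s ⟨hs, t, ht, -, -, hst⟩
  exact (K.isRelLowerSet_faces ht).2 hst hs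

theorem removeIds_le [DecidableEq P] (A : Finset P) (K : PreAbstractSimplicialComplex (P × X)) :
    removeIds A K ≤ K := fun _ hs => hs.1

end Complexes

/-! ### Tasks -/

/-- A task: a finite chromatic input complex, a finite chromatic output complex and a carrier map
from the first to the second. Only the values of `carrier` on input simplices matter. -/
structure DecisionTask (P V W : Type*) where
  input : PreAbstractSimplicialComplex (P × V)
  output : PreAbstractSimplicialComplex (P × W)
  carrier : Finset (P × V) → PreAbstractSimplicialComplex (P × W)
  input_finite : input.faces.Finite
  output_finite : output.faces.Finite
  input_chromatic : IsChromatic input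
  output_chromatic : IsChromatic output
  carrier_le : ∀ s ∈ input, carrier s ≤ output
  carrier_mono : ∀ s ∈ input, ∀ t ∈ input, s ⊆ t → carrier s ≤ carrier t

namespace DecisionTask

variable {P V W : Type*} [Fintype P] [DecidableEq P] [DecidableEq V]

/-- The labels (indices) of the output complexes restricted to `U`: the facets `l` of the
subcomplex of the output complex on the ids of `U` that belong to the carrier of `U`. -/
def IsLabel (T : DecisionTask P V W) (U : Finset (P × V)) (l : Finset (P × W)) : Prop :=
  IsFacet (restrictIds (ids U) T.output) l ∧ l ∈ T.carrier U

/-- The link task of `U` with label `l`. Inputs: the link of `U`. Outputs: the full simplices of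
the output complex that contain `l`, and their faces, with the ids of `U` removed. A simplex `τ` of
the link is carried to the part of the carrier of the joining of `τ` and `U` that lies in the
component with label `l` (its simplices containing `l`, and their faces), with the ids of `U`
removed. -/
def linkTask (T : DecisionTask P V W) (U : Finset (P × V)) (l : Finset (P × W)) : DecisionTask P V W where
  input := link U T.input
  output := removeIds (ids U) (fullStar l T.output)
  carrier τ := removeIds (ids U) (starOf l (T.carrier (τ ∪ U) ⊓ fullStar l T.output))
  input_finite := T.input_finite.subset (link_le U T.input)
  output_finite := T.output_finite.subset fun _ hs => fullStar_le l _ (removeIds_le _ _ hs)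
  input_chromatic s hs := T.input_chromatic s (link_le U T.input hs)
  output_chromatic s hs := T.output_chromatic s (fullStar_le l _ (removeIds_le _ _ hs))
  carrier_le _ _ _ hs := ⟨(starOf_le _ _ hs.1).2, hs.2⟩
  carrier_mono := by
    have key : ∀ s ∈ link U T.input, s ∪ U ∈ T.input := by
      rintro s ⟨⟨hne, t, ht, hUt, hst⟩, -⟩
      exact (T.input.isRelLowerSet_faces ht).2 (Finset.union_subset hst hUt)
        (hne.mono Finset.subset_union_left)
    rintro s hs t ht hst r ⟨⟨hne, q, hq, hlq, hrq⟩, hd⟩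
    exact ⟨⟨hne, q, ⟨T.carrier_mono _ (key s hs) _ (key t ht)
      (Finset.union_subset_union_left hst) hq.1, hq.2⟩, hlq, hrq⟩, hd⟩

end DecisionTask

/-! ### The non-uniform iterated immediate snapshot model -/

/-- Local states of processes, and contents of the cells of immediate snapshot objects. -/
inductive LocalState (P V : Type*) where
  /-- the content of a cell that has not been written; also the state of a process that does not
  take part -/
  | blank : LocalState P V
  /-- the initial state of a process: its id and its input value -/
  | initial (p : P) (x : V) : LocalState P V
  /-- the state after a writeread operation: the id and the snapshot that was returned -/
  | view (p : P) (snapshot : P → LocalState P V) : LocalState P V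

/-- An NIIS protocol is a decision map: in a given local state a process either outputs a value or
continues (`none`). -/
abbrev Protocol (P V W : Type*) := LocalState P V → Option W

/-- A configuration: for every process the number of immediate snapshot objects it has accessed
and its local state, and the contents of the objects; `object r` is the `(r + 1)`-st of them. -/
structure Config (P V : Type*) where
  round : P → ℕ
  state : P → LocalState P V
  object : ℕ → P → LocalState P V

namespace Config

variable {P V W : Type*}

open Classical in
/-- The initial configuration in which exactly the processes of `s` take part, with the inputs
given by `s`. -/
noncomputable def init (s : Finset (P × V)) : Config P V where
  round _ := 0
  state p := if h : ∃ x, (p, x) ∈ s then .initial p h.choose else .blank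
  object _ _ := .blank

/-- The output of a process, if it has terminated. The decision map is consulted after each
writeread operation, so a process that has not taken a step has not terminated. -/
def decision (δ : Protocol P V W) (C : Config P V) (p : P) : Option W :=
  if C.round p = 0 then none else δ (C.state p)

/-- A process is active if it takes part and has not terminated. -/
def IsActive (δ : Protocol P V W) (C : Config P V) (p : P) : Prop :=
  C.state p ≠ .blank ∧ C.decision δ p = none

/-- The scheduler may choose a nonempty set of active processes that are poised to access the same
object. -/
def CanStep (δ : Protocol P V W) (C : Config P V) (B : Finset P) : Prop :=
  B.Nonempty ∧ (∀ p ∈ B, C.IsActive δ p) ∧ ∀ p ∈ B, ∀ q ∈ B, C.round p = C.round q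

variable [DecidableEq P]

/-- The contents of the objects after the processes in `B` have written their states, each to its
own cell of the object it is poised to access. -/
def written (C : Config P V) (B : Finset P) (r : ℕ) (p : P) : LocalState P V :=
  if p ∈ B ∧ C.round p = r then C.state p else C.object r p

/-- The configuration reached when the processes in `B` concurrently perform a writeread
operation: all of them write, and then all of them read. -/
def step (C : Config P V) (B : Finset P) : Config P V where
  round p := if p ∈ B then C.round p + 1 else C.round p
  state p := if p ∈ B then .view p (C.written B (C.round p)) else C.state p
  object := C.written B

/-- The configuration reached by a finite schedule. -/
def run (C : Config P V) (α : List (Finset P)) : Config P V := α.foldl step C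

/-- `α` is a schedule from `C`. -/
def IsSchedule (δ : Protocol P V W) : Config P V → List (Finset P) → Prop
  | _, [] => True
  | C, B :: α => C.CanStep δ B ∧ IsSchedule δ (C.step B) α

/-- `β` is an infinite schedule from `C`. -/
def IsInfiniteSchedule (δ : Protocol P V W) (C : Config P V) (β : ℕ → Finset P) : Prop :=
  ∀ k, C.IsSchedule δ ((List.range k).map β)

/-- The simplex of the outputs of all terminated processes (empty if there are none). -/
def outputs [Fintype P] (δ : Protocol P V W) (C : Config P V) : Finset (P × W) :=
  Finset.univ.filterMap (fun p => (C.decision δ p).map (Prod.mk p)) (by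
    intro p q x hp hq
    obtain ⟨a, -, rfl⟩ := Option.mem_map.1 hp
    obtain ⟨b, -, hb⟩ := Option.mem_map.1 hq
    exact (congrArg Prod.fst hb).symm)

end Config

namespace DecisionTask

variable {P V W : Type*} [Fintype P] [DecidableEq P]

/-- `δ` is wait-free for `T`: there is no infinite schedule from any initial configuration. -/
def WaitFree (T : DecisionTask P V W) (δ : Protocol P V W) : Prop :=
  ∀ s ∈ T.input, ∀ β, ¬ (Config.init s).IsInfiniteSchedule δ β

/-- `δ` solves `T`: in every configuration reached from `s` (with only the processes of `s` taking
steps) the outputs form a simplex of the carrier of `s`. -/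
def Solves (T : DecisionTask P V W) (δ : Protocol P V W) : Prop :=
  ∀ s ∈ T.input, ∀ α, (Config.init s).IsSchedule δ α →
    (((Config.init s).run α).outputs δ).Nonempty →
      ((Config.init s).run α).outputs δ ∈ T.carrier s

/-- `T` has a wait-free protocol. -/
def HasWaitFreeProtocol (T : DecisionTask P V W) : Prop :=
  ∃ δ : Protocol P V W, T.WaitFree δ ∧ T.Solves δ

/-- `δ` is wait-free as a partial protocol with respect to `U`: there is no infinite schedule from
an initial configuration containing `U` in which the first set of processes is `ids U`. -/
def PartialWaitFree (T : DecisionTask P V W) (U : Finset (P × V)) (δ : Protocol P V W) : Prop :=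
  ∀ s ∈ T.input, U ⊆ s → ∀ β, β 0 = ids U → ¬ (Config.init s).IsInfiniteSchedule δ β

/-- `δ` satisfies the task specification as a partial protocol with respect to `U`: the outputs
are correct in every configuration reached from an initial configuration containing `U` by a
schedule in which the first set of processes is `ids U`. -/
def PartialSolves (T : DecisionTask P V W) (U : Finset (P × V)) (δ : Protocol P V W) : Prop :=
  ∀ s ∈ T.input, U ⊆ s → ∀ α, (Config.init s).IsSchedule δ (ids U :: α) →
    (((Config.init s).run (ids U :: α)).outputs δ).Nonempty →
      ((Config.init s).run (ids U :: α)).outputs δ ∈ T.carrier s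

/-- `T` has a (wait-free) partial protocol with respect to `U`. The values of the decision map in
states that do not occur in the executions considered are irrelevant. -/
def HasPartialProtocol (T : DecisionTask P V W) (U : Finset (P × V)) : Prop :=
  ∃ δ : Protocol P V W, T.PartialWaitFree U δ ∧ T.PartialSolves U δ

end DecisionTask

end NIIS

/-!
The two equivalences follow from a cycle of implications: partial protocols for all simplices give
partial protocols for all vertices (trivially), these give wait-free protocols of the link tasks,
and these give back partial protocols for all simplices.

Let `v = (p, x)`. In a partial protocol with respect to `{v}`, let `p` run alone until it
terminates, with output `w` say. The label of the link task is `{(p, w)}`, and the other processes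
solve the link task by pretending that `p` has taken these steps before they started: they insert
into each snapshot the value that `p` has written during its solo execution. As every simplex of the
input is a face of a full one, each execution extends to one in which all processes terminate, so
the outputs together with `(p, w)` lie in a full simplex of the output complex.

Conversely, let `v ∈ U` and let a protocol of the link task of `v` with label `{(p, w)}` be given.
After the first step, performed by all processes of `U` together, `p` terminates with output `w`.
The other processes ignore what `p` has written and run the protocol of the link task; for them the
schedule starts with the set `ids U \ {p}` (which is dropped if it is empty).

Both constructions replace the cells of `p` in all snapshots by prescribed values. This is
`LocalState.graft`, and `Config.Simulates.run` shows that it commutes with the execution of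
schedules.
-/

namespace NIIS

namespace LocalState

variable {P V : Type*}

/-- The process a local state belongs to, if it is not blank. -/
def owner : LocalState P V → Option P
  | blank => none
  | initial p _ => some p
  | view p _ => some p

/-- The number of writeread operations that lead to a local state. A process finds its previous
state in its own cell of the snapshot. -/
def depth : LocalState P V → ℕ
  | blank => 0
  | initial _ _ => 0
  | view p snap => depth (snap p) + 1

/-- Replaces, in all snapshots a local state consists of, the cell of `p`: in snapshots of the
`(r + 1)`-st object it becomes `ρ r`. -/
def graft [DecidableEq P] (p : P) (ρ : ℕ → LocalState P V) : LocalState P V → LocalState P V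
  | blank => blank
  | initial q x => initial q x
  | view q snap => view q fun u => if u = p then ρ (depth (snap q)) else graft p ρ (snap u)

theorem graft_eq_blank_iff [DecidableEq P] {p : P} {ρ : ℕ → LocalState P V}
    {a : LocalState P V} : graft p ρ a = blank ↔ a = blank := by
  cases a <;> simp [graft]

end LocalState

namespace Config

variable {P V W : Type*}

/-! ### Initial configurations and outputs -/

theorem init_state_of_mem {s : Finset (P × V)} (hs : Set.InjOn Prod.fst (s : Set (P × V))) {p : P}
    {x : V} (hx : (p, x) ∈ s) : (init s).state p = .initial p x := by
  have h : ∃ x, (p, x) ∈ s := ⟨x, hx⟩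
  have h' : h.choose = x := congrArg Prod.snd (hs h.choose_spec hx rfl)
  simp only [init, dif_pos h, h']

theorem init_state_of_notMem {s : Finset (P × V)} {p : P} (hp : ∀ x, (p, x) ∉ s) :
    (init s).state p = .blank :=
  dif_neg fun ⟨x, hx⟩ => hp x hx

theorem exists_mem_of_init_state_ne_blank {s : Finset (P × V)} {p : P}
    (h : (init s).state p ≠ .blank) : ∃ x, (p, x) ∈ s := by
  by_contra! h'
  exact h (init_state_of_notMem h')

theorem mem_outputs [Fintype P] {δ : Protocol P V W} {C : Config P V} {p : P} {w : W} :
    (p, w) ∈ C.outputs δ ↔ C.decision δ p = some w := by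
  simp only [outputs, Finset.mem_filterMap, Finset.mem_univ, true_and, Option.map_eq_some_iff,
    Prod.mk.injEq]
  constructor
  · rintro ⟨q, a, h, rfl, rfl⟩
    exact h
  · exact fun h => ⟨p, w, h, rfl, rfl⟩

/-! ### Schedules -/

section Schedules

variable [DecidableEq P] {δ : Protocol P V W} {C : Config P V} {B : Finset P}
  {α γ : List (Finset P)} {p : P}

theorem isSchedule_append :
    C.IsSchedule δ (α ++ γ) ↔ C.IsSchedule δ α ∧ (C.run α).IsSchedule δ γ := by
  induction α generalizing C with
  | nil => simp [IsSchedule, run]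
  | cons B α ih => simp [IsSchedule, run, ih, and_assoc]

theorem run_append : C.run (α ++ γ) = (C.run α).run γ := List.foldl_append

theorem run_cons : C.run (B :: α) = (C.step B).run α := rfl

theorem step_empty : C.step ∅ = C := by
  have h : C.written ∅ = C.object := by
    funext r q
    simp [written]
  simp [step, h]

theorem step_state_of_notMem (h : p ∉ B) : (C.step B).state p = C.state p := if_neg h

theorem step_round_of_notMem (h : p ∉ B) : (C.step B).round p = C.round p := if_neg h

theorem step_decision_of_notMem (h : p ∉ B) :
    (C.step B).decision δ p = C.decision δ p := by
  simp [decision, step_state_of_notMem h, step_round_of_notMem h]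

theorem step_isActive_of_notMem (h : p ∉ B) :
    (C.step B).IsActive δ p ↔ C.IsActive δ p := by
  simp [IsActive, step_state_of_notMem h, step_decision_of_notMem h]

theorem step_state_ne_blank (h : C.state p ≠ .blank) : (C.step B).state p ≠ .blank := by
  by_cases hp : p ∈ B
  · simp [step, hp]
  · rwa [step_state_of_notMem hp]

theorem run_state_ne_blank (h : C.state p ≠ .blank) : (C.run α).state p ≠ .blank := by
  induction α generalizing C with
  | nil => exact h
  | cons B α ih => exact ih (step_state_ne_blank h)

theorem run_decision_of_decision_eq_some {w : W} (hα : C.IsSchedule δ α)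
    (h : C.decision δ p = some w) : (C.run α).decision δ p = some w := by
  induction α generalizing C with
  | nil => exact h
  | cons B α ih =>
    refine ih hα.2 ?_
    rwa [step_decision_of_notMem]
    intro hp
    simp [(hα.1.2.1 p hp).2] at h

theorem run_of_state_eq_blank (hα : C.IsSchedule δ α) (h : C.state p = .blank) :
    (C.run α).state p = .blank ∧ (C.run α).round p = C.round p ∧
      ∀ r, (C.run α).object r p = C.object r p := by
  induction α generalizing C with
  | nil => exact ⟨h, rfl, fun _ => rfl⟩
  | cons B α ih =>
    have hp : p ∉ B := fun hp => (hα.1.2.1 p hp).1 h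
    obtain ⟨h₁, h₂, h₃⟩ := ih hα.2 ((step_state_of_notMem hp).trans h)
    exact ⟨h₁, h₂.trans (step_round_of_notMem hp),
      fun r => (h₃ r).trans (by simp [step, written, hp])⟩

theorem not_isInfiniteSchedule_step (h : ∀ β : ℕ → Finset P, β 0 = B → ¬ C.IsInfiniteSchedule δ β)
    (hB : C.CanStep δ B) (β : ℕ → Finset P) : ¬ (C.step B).IsInfiniteSchedule δ β := by
  intro hβ
  refine h (fun k => Nat.casesOn k B β) rfl fun k => ?_
  cases k with
  | zero => trivial
  | succ k =>
    rw [List.range_succ_eq_map, List.map_cons, List.map_map]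
    exact ⟨hB, hβ k⟩

theorem not_isInfiniteSchedule_run (h : ∀ β, ¬ C.IsInfiniteSchedule δ β) (hα : C.IsSchedule δ α)
    (β : ℕ → Finset P) : ¬ (C.run α).IsInfiniteSchedule δ β := by
  induction α generalizing C with
  | nil => exact h β
  | cons B α ih => exact ih (not_isInfiniteSchedule_step (fun β _ => h β) hα.1) hα.2

/-- If there is no infinite schedule, then some schedule leads to a configuration in which no
process is active: otherwise one could forever let some active process take a step. -/
theorem exists_isSchedule_forall_not_isActive (h : ∀ β, ¬ C.IsInfiniteSchedule δ β) :
    ∃ α, C.IsSchedule δ α ∧ ∀ p, ¬ (C.run α).IsActive δ p := by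
  by_contra! h'
  have : Nonempty P := ⟨(h' [] trivial).choose⟩
  choose! f hf using h'
  let g : ℕ → List (Finset P) := fun k => Nat.rec [] (fun _ α => α ++ [{f α}]) k
  have hg : ∀ k, C.IsSchedule δ (g k) := by
    intro k
    induction k with
    | zero => trivial
    | succ k ih =>
      refine isSchedule_append.2 ⟨ih, ⟨⟨Finset.singleton_nonempty _, ?_, ?_⟩, trivial⟩⟩
      · intro p hp
        rw [Finset.mem_singleton.1 hp]
        exact hf _ ih
      · intro p hp q hq
        rw [Finset.mem_singleton.1 hp, Finset.mem_singleton.1 hq]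
  refine h (fun k => {f (g k)}) fun k => ?_
  suffices (List.range k).map (fun k => ({f (g k)} : Finset P)) = g k from this ▸ hg k
  induction k with
  | zero => rfl
  | succ k ih => rw [List.range_succ, List.map_append, ih]; rfl

theorem outputs_subset_run [Fintype P] (hα : C.IsSchedule δ α) :
    C.outputs δ ⊆ (C.run α).outputs δ := by
  rintro ⟨q, w⟩ h
  exact mem_outputs.2 (run_decision_of_decision_eq_some hα (mem_outputs.1 h))

end Schedules

/-! ### Adding processes that take no steps -/

section Extension

variable {δ : Protocol P V W} {C D : Config P V} {B : Finset P} {α : List (Finset P)} {p : P}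

/-- `D` arises from `C` by letting further processes take part that have not taken any step: the
processes whose state in `C` is blank may have any state in `D`. -/
structure ExtendedBy (C D : Config P V) : Prop where
  object_eq : D.object = C.object
  state_eq : ∀ q, C.state q ≠ .blank → D.state q = C.state q
  round_eq : ∀ q, D.round q = C.round q

theorem ExtendedBy.decision_eq (h : ExtendedBy C D) (hp : C.state p ≠ .blank ∨ C.round p = 0) :
    D.decision δ p = C.decision δ p := by
  rcases hp with hp | hp
  · simp [decision, h.round_eq, h.state_eq p hp]
  · simp [decision, h.round_eq, hp]

theorem extendedBy_init {s t : Finset (P × V)} (ht : Set.InjOn Prod.fst (t : Set (P × V)))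
    (hst : s ⊆ t) : ExtendedBy (init s) (init t) := by
  refine ⟨rfl, fun q hq => ?_, fun _ => rfl⟩
  obtain ⟨x, hx⟩ := exists_mem_of_init_state_ne_blank hq
  have hs : Set.InjOn Prod.fst (s : Set (P × V)) := ht.mono (by exact_mod_cast hst)
  rw [init_state_of_mem hs hx, init_state_of_mem ht (hst hx)]

variable [DecidableEq P]

theorem ExtendedBy.step (h : ExtendedBy C D) (hB : ∀ q ∈ B, C.state q ≠ .blank) :
    ExtendedBy (C.step B) (D.step B) := by
  have hw : D.written B = C.written B := by
    funext r q
    by_cases hq : q ∈ B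
    · simp [written, h.object_eq, h.round_eq, h.state_eq q (hB q hq)]
    · simp [written, h.object_eq, hq]
  refine ⟨hw, fun q hq => ?_, fun q => ?_⟩
  · by_cases hqB : q ∈ B
    · simp [Config.step, hqB, hw, h.round_eq]
    · rw [step_state_of_notMem hqB] at hq ⊢
      rw [step_state_of_notMem hqB, h.state_eq q hq]
  · simp [Config.step, h.round_eq]

theorem ExtendedBy.run (h : ExtendedBy C D) (hα : C.IsSchedule δ α) :
    D.IsSchedule δ α ∧ ExtendedBy (C.run α) (D.run α) ∧
      ∀ q, C.state q = .blank → (D.run α).state q = D.state q := by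
  induction α generalizing C D with
  | nil => exact ⟨trivial, h, fun _ _ => rfl⟩
  | cons B α ih =>
    have hB : ∀ q ∈ B, C.state q ≠ .blank := fun q hq => (hα.1.2.1 q hq).1
    obtain ⟨h₁, h₂, h₃⟩ := ih (h.step hB) hα.2
    refine ⟨⟨⟨hα.1.1, fun q hq => ⟨?_, ?_⟩, fun q hq u hu => ?_⟩, h₁⟩, h₂, fun q hq => ?_⟩
    · rw [h.state_eq q (hB q hq)]
      exact hB q hq
    · rw [h.decision_eq (Or.inl (hB q hq))]
      exact (hα.1.2.1 q hq).2
    · rw [h.round_eq, h.round_eq]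
      exact hα.1.2.2 q hq u hu
    · have hqB : q ∉ B := fun hqB => hB q hqB hq
      rw [run_cons, h₃ q ((step_state_of_notMem hqB).trans hq), step_state_of_notMem hqB]

/-- An execution from `s` is also one from every larger input, with the same outputs. -/
theorem isSchedule_init_of_subset [Fintype P] {s t : Finset (P × V)}
    (ht : Set.InjOn Prod.fst (t : Set (P × V))) (hst : s ⊆ t) (hα : (init s).IsSchedule δ α) :
    (init t).IsSchedule δ α ∧ ((init t).run α).outputs δ = ((init s).run α).outputs δ := by
  obtain ⟨h₁, h₂, -⟩ := (extendedBy_init ht hst).run hα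
  refine ⟨h₁, ?_⟩
  ext ⟨q, w⟩
  rw [mem_outputs, mem_outputs, h₂.decision_eq]
  by_cases hq : (init s).state q = .blank
  · exact Or.inr (run_of_state_eq_blank hα hq).2.1
  · exact Or.inl (run_state_ne_blank hq)

end Extension

/-! ### Simulation -/

section Simulation

variable {δ δ' : Protocol P V W} {C D : Config P V} {B : Finset P} {α : List (Finset P)} {p : P}
  {ρ : ℕ → LocalState P V}

/-- Every local state belongs to its process, and its depth is the number of steps taken. -/
def WellFormed (C : Config P V) : Prop :=
  ∀ q, (C.state q).depth = C.round q ∧ (C.state q = .blank ∨ (C.state q).owner = some q)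

theorem wellFormed_init (s : Finset (P × V)) : (init s).WellFormed := by
  intro q
  by_cases h : ∃ x, (q, x) ∈ s <;> simp [init, h, LocalState.depth, LocalState.owner]

variable [DecidableEq P]

theorem WellFormed.step (h : C.WellFormed) (B : Finset P) : (C.step B).WellFormed := by
  intro q
  by_cases hq : q ∈ B
  · simp [Config.step, hq, LocalState.depth, LocalState.owner, written, (h q).1]
  · simpa [Config.step, hq] using h q

/-- Up to the cells of `p`, which have the content `ρ` in `D`, the configuration `D` is obtained
from `C` by `LocalState.graft p ρ`. The state of `p` and its cells in `C` are disregarded. -/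
structure Simulates (p : P) (ρ : ℕ → LocalState P V) (C D : Config P V) : Prop where
  round_eq : ∀ q ≠ p, D.round q = C.round q
  state_eq : ∀ q ≠ p, D.state q = (C.state q).graft p ρ
  object_eq : ∀ r, ∀ q ≠ p, D.object r q = (C.object r q).graft p ρ
  object_self : ∀ r, D.object r p = ρ r

theorem Simulates.step (h : Simulates p ρ C D) (hC : C.WellFormed) (B : Finset P) :
    Simulates p ρ (C.step B) (D.step (B.erase p)) := by
  have hw : ∀ r, ∀ q ≠ p, D.written (B.erase p) r q = (C.written B r q).graft p ρ := by
    intro r q hq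
    simp only [written, Finset.mem_erase, ne_eq, hq, not_false_eq_true, true_and, h.round_eq q hq,
      h.state_eq q hq, h.object_eq r q hq]
    split_ifs <;> rfl
  have hp : ∀ r, D.written (B.erase p) r p = ρ r := fun r => by simp [written, h.object_self]
  refine ⟨fun q hq => ?_, fun q hq => ?_, hw, hp⟩
  · simp [Config.step, hq, h.round_eq q hq]
  · by_cases hqB : q ∈ B
    · have hd : (C.written B (C.round q) q).depth = C.round q := by simp [written, hqB, (hC q).1]
      simp only [Config.step, Finset.mem_erase, ne_eq, hq, not_false_eq_true, true_and, hqB,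
        if_true, LocalState.graft, h.round_eq q hq, hd, LocalState.view.injEq]
      funext u
      split_ifs with hu
      · rw [hu, hp]
      · exact hw _ u hu
    · simp [Config.step, hqB, h.state_eq q hq]

theorem Simulates.decision_eq (h : Simulates p ρ C D) (hC : C.WellFormed)
    (hδ : ∀ a : LocalState P V, a.owner ≠ some p → δ a = δ' (a.graft p ρ)) {q : P} (hq : q ≠ p) :
    D.decision δ' q = C.decision δ q := by
  rw [decision, decision, h.round_eq q hq, h.state_eq q hq, hδ]
  rcases (hC q).2 with h | h
  · simp [h, LocalState.owner]
  · simpa [h] using hq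

theorem Simulates.canStep_erase (h : Simulates p ρ C D) (hC : C.WellFormed)
    (hδ : ∀ a : LocalState P V, a.owner ≠ some p → δ a = δ' (a.graft p ρ))
    (hB : C.CanStep δ B) (hne : (B.erase p).Nonempty) : D.CanStep δ' (B.erase p) := by
  refine ⟨hne, fun q hq => ?_, fun q hq u hu => ?_⟩
  · obtain ⟨hqp, hqB⟩ := Finset.mem_erase.1 hq
    have hqa := hB.2.1 q hqB
    refine ⟨?_, (h.decision_eq hC hδ hqp).trans hqa.2⟩
    rw [h.state_eq q hqp, ne_eq, LocalState.graft_eq_blank_iff]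
    exact hqa.1
  · obtain ⟨hqp, hqB⟩ := Finset.mem_erase.1 hq
    obtain ⟨hup, huB⟩ := Finset.mem_erase.1 hu
    rw [h.round_eq q hqp, h.round_eq u hup]
    exact hB.2.2 q hqB u huB

/-- If `p` takes no more steps and the protocols agree up to grafting, then the schedules from `C`
are schedules from `D`, and lead to the same decisions of all processes other than `p`. -/
theorem Simulates.run (h : Simulates p ρ C D) (hC : C.WellFormed) (hp : ¬ C.IsActive δ p)
    (hδ : ∀ a : LocalState P V, a.owner ≠ some p → δ a = δ' (a.graft p ρ))
    (hα : C.IsSchedule δ α) :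
    D.IsSchedule δ' α ∧ ∀ q ≠ p, (D.run α).decision δ' q = (C.run α).decision δ q := by
  induction α generalizing C D with
  | nil => exact ⟨trivial, fun q hq => h.decision_eq hC hδ hq⟩
  | cons B α ih =>
    have hpB : p ∉ B := fun hpB => hp (hα.1.2.1 p hpB)
    have hB : B.erase p = B := Finset.erase_eq_of_notMem hpB
    have h₁ := h.canStep_erase hC hδ hα.1
    have h₂ := h.step hC B
    rw [hB] at h₁ h₂
    obtain ⟨h₃, h₄⟩ := ih h₂ (hC.step B) (by rwa [step_isActive_of_notMem hpB]) hα.2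
    exact ⟨⟨h₁ hα.1.1, h₃⟩, h₄⟩

end Simulation

end Config

/-! ### Links of vertices -/

theorem mem_of_mem_of_subset {P X : Type*} {L : PreAbstractSimplicialComplex (P × X)}
    {s t : Finset (P × X)} (ht : t ∈ L) (hst : s ⊆ t) (hs : s.Nonempty) : s ∈ L :=
  (L.isRelLowerSet_faces ht).2 hst hs

theorem ids_singleton {P X : Type*} [DecidableEq P] (v : P × X) : ids {v} = {v.1} :=
  Finset.image_singleton _ _

section Links

variable {P V : Type*} [DecidableEq V] {K : PreAbstractSimplicialComplex (P × V)}

theorem insert_mem_of_mem_link [DecidableEq P] {v : P × V} {τ : Finset (P × V)}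
    (h : τ ∈ link {v} K) : τ ∪ {v} ∈ K := by
  obtain ⟨⟨hne, t, ht, hvt, hτt⟩, -⟩ := h
  exact mem_of_mem_of_subset ht (Finset.union_subset hτt hvt)
    (hne.mono Finset.subset_union_left)

theorem notMem_of_mem_link [DecidableEq P] (hK : IsChromatic K) {v : P × V} {τ : Finset (P × V)}
    (h : τ ∈ link {v} K) (x : V) : (v.1, x) ∉ τ := by
  intro hx
  have hv : (v.1, x) = v := hK _ (insert_mem_of_mem_link h) (by simp [hx]) (by simp) rfl
  exact Finset.disjoint_singleton_right.1 h.2 (hv ▸ hx)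

theorem erase_mem_link [DecidableEq P] {v : P × V} {s : Finset (P × V)} (hs : s ∈ K) (hv : v ∈ s)
    (hne : (s.erase v).Nonempty) : s.erase v ∈ link {v} K :=
  ⟨⟨hne, s, hs, by simpa, Finset.erase_subset _ _⟩, by simp⟩

end Links

namespace DecisionTask

variable {P V W : Type*} [DecidableEq P] {T : DecisionTask P V W}

theorem singleton_isLabel {v : P × V} {w : W} (hw : {(v.1, w)} ∈ T.carrier {v})
    (hv : {v} ∈ T.input) : T.IsLabel {v} {(v.1, w)} := by
  refine ⟨⟨⟨T.carrier_le _ hv hw, by simp [ids]⟩, ?_⟩, hw⟩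
  rintro t ⟨ht, hti⟩ hsub
  refine Finset.Subset.antisymm ?_ hsub
  intro y hy
  have h₁ : y.1 = v.1 := by
    simpa [ids_singleton] using hti (Finset.mem_image_of_mem Prod.fst hy)
  have h₂ : (v.1, w) ∈ t := hsub (Finset.mem_singleton_self _)
  exact Finset.mem_singleton.2 (T.output_chromatic t ht hy h₂ h₁)

theorem IsLabel.exists_eq_singleton {v : P × V} {l : Finset (P × W)} (h : T.IsLabel {v} l) :
    ∃ w, l = {(v.1, w)} := by
  obtain ⟨⟨⟨hl, hli⟩, -⟩, -⟩ := h
  have hfst : ∀ y ∈ l, y.1 = v.1 := fun y hy => by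
    simpa [ids_singleton] using hli (Finset.mem_image_of_mem Prod.fst hy)
  obtain ⟨y, hy⟩ : l.Nonempty := (T.output.isRelLowerSet_faces hl).1
  refine ⟨y.2, ?_⟩
  rw [← hfst y hy]
  exact Finset.eq_singleton_iff_unique_mem.2
    ⟨hy, fun z hz => T.output_chromatic l hl hz hy ((hfst z hz).trans (hfst y hy).symm)⟩

open Config LocalState

theorem PartialWaitFree.not_isInfiniteSchedule_run {U s : Finset (P × V)} {δ : Protocol P V W}
    (h : T.PartialWaitFree U δ) (hs : s ∈ T.input) (hU : U ⊆ s) {α : List (Finset P)}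
    (hα : (init s).IsSchedule δ (ids U :: α)) (β : ℕ → Finset P) :
    ¬ ((init s).run (ids U :: α)).IsInfiniteSchedule δ β :=
  Config.not_isInfiniteSchedule_run (not_isInfiniteSchedule_step (h s hs hU) hα.1) hα.2 β

/-! ### From partial protocols to link tasks -/

/-- In a partial protocol with respect to a vertex, the solo execution of its process ends with an
output. -/
theorem exists_solo_execution {v : P × V} {δ : Protocol P V W} (hv : {v} ∈ T.input)
    (hwf : T.PartialWaitFree {v} δ) : ∃ (w : W) (α : List (Finset P)),
      (init {v}).IsSchedule δ (ids {v} :: α) ∧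
        ((init {v}).run (ids {v} :: α)).decision δ v.1 = some w := by
  have hst : (init {v}).state v.1 = .initial v.1 v.2 :=
    init_state_of_mem (T.input_chromatic _ hv) (by simp)
  have hstep : (init {v}).CanStep δ (ids {v}) := by
    simp [CanStep, ids_singleton, IsActive, decision, init]
  obtain ⟨α, hα, hact⟩ := exists_isSchedule_forall_not_isActive
    (not_isInfiniteSchedule_step (hwf _ hv subset_rfl) hstep)
  have hne : ((init {v}).run (ids {v} :: α)).state v.1 ≠ .blank :=
    run_state_ne_blank (by simp [hst])
  have hd : ((init {v}).run (ids {v} :: α)).decision δ v.1 ≠ none := fun h =>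
    hact v.1 ⟨hne, h⟩
  obtain ⟨w, hw⟩ := Option.ne_none_iff_exists'.1 hd
  exact ⟨w, α, ⟨hstep, hα⟩, hw⟩

/-- If every input simplex lies in a full one, then the outputs of an execution of a partial
protocol lie in a full simplex of the output complex: let all processes take part, and let them run
until they have terminated. -/
theorem exists_full_outputs [Fintype P] (hT : IsFull T.input) {U s : Finset (P × V)}
    {δ : Protocol P V W} (hwf : T.PartialWaitFree U δ) (hsol : T.PartialSolves U δ)
    (hs : s ∈ T.input) (hU : U ⊆ s) {α : List (Finset P)} (hα : (init s).IsSchedule δ (ids U :: α))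
    (hne : (((init s).run (ids U :: α)).outputs δ).Nonempty) :
    ∃ t ∈ T.output, ids t = Finset.univ ∧ ((init s).run (ids U :: α)).outputs δ ⊆ t := by
  obtain ⟨t, ht, hst, htu⟩ := hT s hs
  obtain ⟨hα', hout⟩ := isSchedule_init_of_subset (T.input_chromatic t ht) hst hα
  obtain ⟨γ, hγ, hact⟩ := exists_isSchedule_forall_not_isActive
    (hwf.not_isInfiniteSchedule_run ht (hU.trans hst) hα')
  have hsub := outputs_subset_run hγ
  rw [hout, ← run_append, List.cons_append] at hsub
  have hmem := hsol t ht (hU.trans hst) (α ++ γ) (isSchedule_append.2 ⟨hα', hγ⟩)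
    (hne.mono hsub)
  refine ⟨_, T.carrier_le t ht hmem, Finset.eq_univ_iff_forall.2 fun q => ?_, hsub⟩
  obtain ⟨⟨q', x⟩, hx, rfl⟩ := Finset.mem_image.1 (htu ▸ Finset.mem_univ q)
  have hst' : (init t).state q' ≠ .blank := by
    simp [init_state_of_mem (T.input_chromatic t ht) hx]
  have hd : ((init t).run (ids U :: (α ++ γ))).decision δ q' ≠ none := by
    intro h
    rw [← List.cons_append, run_append] at h
    exact hact q' ⟨run_state_ne_blank (run_state_ne_blank hst'), h⟩
  obtain ⟨w, hw⟩ := Option.ne_none_iff_exists'.1 hd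
  exact Finset.mem_image.2 ⟨(q', w), mem_outputs.2 hw, rfl⟩

theorem HasPartialProtocol.exists_linkTask_hasWaitFreeProtocol [Fintype P] [DecidableEq V]
    (hT : IsFull T.input) {v : P × V} (hv : {v} ∈ T.input) (h : T.HasPartialProtocol {v}) :
    ∃ l, T.IsLabel {v} l ∧ (T.linkTask {v} l).HasWaitFreeProtocol := by
  obtain ⟨δ, hwf, hsol⟩ := h
  obtain ⟨w, α₀, hα₀, hw⟩ := exists_solo_execution hv hwf
  let ρ : ℕ → LocalState P V := fun r => ((init {v}).run (ids {v} :: α₀)).object r v.1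
  have hwmem : {(v.1, w)} ∈ T.carrier {v} := by
    have hmem := mem_outputs.2 hw
    exact mem_of_mem_of_subset (hsol _ hv subset_rfl α₀ hα₀ ⟨_, hmem⟩) (by simpa using hmem)
      (Finset.singleton_nonempty _)
  -- All cells other than those of `v.1` are still empty after the solo execution, and the other
  -- processes are still in their initial states.
  have key : ∀ τ ∈ link {v} T.input,
      (init (τ ∪ {v})).IsSchedule δ (ids {v} :: α₀) ∧
        ((init (τ ∪ {v})).run (ids {v} :: α₀)).decision δ v.1 = some w ∧
        Simulates v.1 ρ (init τ) ((init (τ ∪ {v})).run (ids {v} :: α₀)) := by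
    intro τ hτ
    have hs := insert_mem_of_mem_link hτ
    have hsc := T.input_chromatic _ hs
    have hτv := notMem_of_mem_link T.input_chromatic hτ
    obtain ⟨h₁, h₂, h₃⟩ := (extendedBy_init hsc Finset.subset_union_right).run hα₀
    have hbl : ∀ q ≠ v.1, (init {v}).state q = .blank := fun q hq =>
      init_state_of_notMem fun x hx => hq (congrArg Prod.fst (Finset.mem_singleton.1 hx))
    have hst : (init {v}).state v.1 ≠ .blank := by
      simp [init_state_of_mem (T.input_chromatic _ hv) (p := v.1) (x := v.2) (by simp)]
    refine ⟨h₁, ?_, fun q hq => ?_, fun q hq => ?_, fun r q hq => ?_, fun r => ?_⟩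
    · rw [h₂.decision_eq (Or.inl (run_state_ne_blank hst)), hw]
    · rw [h₂.round_eq, (run_of_state_eq_blank hα₀ (hbl q hq)).2.1]
      rfl
    · rw [h₃ q (hbl q hq)]
      by_cases hx : ∃ x, (q, x) ∈ τ
      · obtain ⟨x, hx⟩ := hx
        rw [init_state_of_mem hsc (Finset.mem_union_left _ hx),
          init_state_of_mem (T.input_chromatic _ (link_le _ _ hτ)) hx, graft]
      · push Not at hx
        rw [init_state_of_notMem hx, init_state_of_notMem, graft]
        intro x hx'
        rcases Finset.mem_union.1 hx' with hx' | hx'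
        · exact hx x hx'
        · exact hq (congrArg Prod.fst (Finset.mem_singleton.1 hx'))
    · rw [h₂.object_eq, (run_of_state_eq_blank hα₀ (hbl q hq)).2.2]
      rfl
    · rw [h₂.object_eq]
  have hna : ∀ τ ∈ link {v} T.input, (init τ).state v.1 = .blank := fun τ hτ =>
    init_state_of_notMem (notMem_of_mem_link T.input_chromatic hτ)
  refine ⟨{(v.1, w)}, singleton_isLabel hwmem hv, fun a => δ (a.graft v.1 ρ), ?_, ?_⟩
  · intro τ hτ β hβ
    obtain ⟨h₁, -, h₂⟩ := key τ hτ
    refine hwf.not_isInfiniteSchedule_run (insert_mem_of_mem_link hτ) Finset.subset_union_right h₁ β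
      fun k => ?_
    exact (h₂.run (wellFormed_init τ) (fun h => h.1 (hna τ hτ)) (fun _ _ => rfl) (hβ k)).1
  · intro τ hτ α hα hne
    obtain ⟨h₁, h₂, h₃⟩ := key τ hτ
    have hs : τ ∪ {v} ∈ T.input := insert_mem_of_mem_link hτ
    have hvs : {v} ⊆ τ ∪ {v} := Finset.subset_union_right
    obtain ⟨hα', hdec⟩ :=
      h₃.run (wellFormed_init τ) (fun h => h.1 (hna τ hτ)) (fun _ _ => rfl) hα
    have hα₁ : (init (τ ∪ {v})).IsSchedule δ (ids {v} :: (α₀ ++ α)) :=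
      isSchedule_append.2 ⟨h₁, hα'⟩
    have hrun : (init (τ ∪ {v})).run (ids {v} :: (α₀ ++ α)) =
        ((init (τ ∪ {v})).run (ids {v} :: α₀)).run α := run_append
    have hvd : ((init τ).run α).decision (fun a => δ (a.graft v.1 ρ)) v.1 = none := by
      rw [decision, (run_of_state_eq_blank hα (hna τ hτ)).2.1]
      rfl
    have hvout : (v.1, w) ∈ ((init (τ ∪ {v})).run (ids {v} :: (α₀ ++ α))).outputs δ := by
      rw [mem_outputs, hrun]
      exact run_decision_of_decision_eq_some hα' h₂
    have hsub : ((init τ).run α).outputs (fun a => δ (a.graft v.1 ρ)) ⊆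
        ((init (τ ∪ {v})).run (ids {v} :: (α₀ ++ α))).outputs δ := by
      rintro ⟨q, y⟩ hy
      rw [mem_outputs] at hy
      have hq : q ≠ v.1 := by
        rintro rfl
        simp [hvd] at hy
      rw [mem_outputs, hrun, hdec q hq, hy]
    obtain ⟨t, ht, htu, hst⟩ := exists_full_outputs hT hwf hsol hs hvs hα₁ ⟨_, hvout⟩
    have hmem := hsol _ hs hvs _ hα₁ ⟨_, hvout⟩
    have hl : {(v.1, w)} ⊆ ((init (τ ∪ {v})).run (ids {v} :: (α₀ ++ α))).outputs δ := by
      simpa using hvout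
    refine ⟨⟨hne, _, ⟨hmem, ⟨⟨_, hvout⟩, t, ht, htu, hl.trans hst, hst⟩⟩, hl, hsub⟩, ?_⟩
    rw [ids_singleton, Finset.disjoint_singleton_right, ids, Finset.mem_image]
    rintro ⟨⟨q, y⟩, hy, rfl⟩
    rw [mem_outputs, hvd] at hy
    cases hy

/-! ### From link tasks to partial protocols -/

/-- The decision map in which `p` outputs `w` at its first opportunity, and the other processes
follow `δ`, disregarding everything that `p` has written. -/
def ignoring (p : P) (w : W) (δ : Protocol P V W) : Protocol P V W := fun a =>
  if a.owner = some p then some w else δ (a.graft p fun _ => .blank)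

/-- A link protocol of any one vertex of `U` gives a partial protocol with respect to `U`. -/
theorem hasPartialProtocol_of_linkTask [Fintype P] [DecidableEq V] {U : Finset (P × V)}
    (hU : U ∈ T.input) {v : P × V} (hvU : v ∈ U) {l : Finset (P × W)} (hl : T.IsLabel {v} l)
    (h : (T.linkTask {v} l).HasWaitFreeProtocol) : T.HasPartialProtocol U := by
  obtain ⟨w, rfl⟩ := hl.exists_eq_singleton
  obtain ⟨δ', hwf, hsol⟩ := h
  have hv : {v} ∈ T.input :=
    mem_of_mem_of_subset hU (by simpa using hvU) (Finset.singleton_nonempty _)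
  set δ : Protocol P V W := ignoring v.1 w δ' with hδdef
  have hδ : ∀ a : LocalState P V, a.owner ≠ some v.1 → δ a = δ' (a.graft v.1 fun _ => .blank) :=
    fun a ha => if_neg ha
  have hvids : v.1 ∈ ids U := Finset.mem_image_of_mem _ hvU
  have hdec : ∀ s : Finset (P × V), ((init s).step (ids U)).decision δ v.1 = some w := by
    intro s
    simp [decision, Config.step, hvids, hδdef, ignoring, owner]
  have hsim₀ : ∀ s ∈ T.input, v ∈ s →
      Simulates v.1 (fun _ => .blank) (init s) (init (s.erase v)) := by
    intro s hs hvs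
    refine ⟨fun _ _ => rfl, fun q hq => ?_, fun _ _ _ => rfl, fun _ => rfl⟩
    have hsc := T.input_chromatic s hs
    by_cases hx : ∃ x, (q, x) ∈ s
    · obtain ⟨x, hx⟩ := hx
      have hx' : (q, x) ∈ s.erase v :=
        Finset.mem_erase.2 ⟨fun h => hq (congrArg Prod.fst h), hx⟩
      rw [init_state_of_mem hsc hx, graft,
        init_state_of_mem (hsc.mono (by exact_mod_cast Finset.erase_subset _ _)) hx']
    · push Not at hx
      rw [init_state_of_notMem hx, graft,
        init_state_of_notMem fun x hx' => hx x (Finset.mem_of_mem_erase hx')]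
  -- The processes other than `v.1` execute the link protocol. Its schedule starts with
  -- `(ids U).erase v.1`, unless this set is empty.
  have key : ∀ s ∈ T.input, U ⊆ s → (init s).CanStep δ (ids U) → ∃ α₀ : List (Finset P),
      (init (s.erase v)).IsSchedule δ' α₀ ∧ ∀ α, ((init s).step (ids U)).IsSchedule δ α →
        ((init (s.erase v)).run α₀).IsSchedule δ' α ∧
        ∀ q ≠ v.1, (((init (s.erase v)).run α₀).run α).decision δ' q =
          (((init s).step (ids U)).run α).decision δ q := by
    intro s hs hUs hB
    have h₀ := hsim₀ s hs (hUs hvU)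
    have hwf₀ := wellFormed_init s
    have h₁ := h₀.step hwf₀ (ids U)
    have hna : ¬ ((init s).step (ids U)).IsActive δ v.1 := fun h => by
      simp [hdec s, IsActive] at h
    rcases ((ids U).erase v.1).eq_empty_or_nonempty with he | hne
    · rw [he, step_empty] at h₁
      exact ⟨[], trivial, fun α hα => h₁.run (hwf₀.step _) hna hδ hα⟩
    · exact ⟨[(ids U).erase v.1], ⟨h₀.canStep_erase hwf₀ hδ hB hne, trivial⟩,
        fun α hα => h₁.run (hwf₀.step _) hna hδ hα⟩
  have hempty : ∀ (s : Finset (P × V)) (α : List (Finset P)), s.erase v = ∅ →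
      (init (s.erase v)).IsSchedule δ' α → α = [] := by
    intro s α he hα
    cases α with
    | nil => rfl
    | cons B α =>
      obtain ⟨q, hq⟩ := hα.1.1
      exact absurd (init_state_of_notMem (by simp [he])) (hα.1.2.1 q hq).1
  refine ⟨δ, ?_, ?_⟩
  · intro s hs hUs β hβ₀ hβ
    have hB : (init s).CanStep δ (ids U) := hβ₀ ▸ (hβ 1).1
    obtain ⟨α₀, hα₀, hrun⟩ := key s hs hUs hB
    have hβ' : ((init (s.erase v)).run α₀).IsInfiniteSchedule δ' fun k => β (k + 1) := by
      intro k
      refine (hrun _ ?_).1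
      have := hβ (k + 1)
      rw [List.range_succ_eq_map, List.map_cons, List.map_map, hβ₀] at this
      exact this.2
    rcases (s.erase v).eq_empty_or_nonempty with he | hne
    · have := hempty s _ he (isSchedule_append.2 ⟨hα₀, hβ' 1⟩)
      simp at this
    · exact Config.not_isInfiniteSchedule_run (hwf _ (erase_mem_link hs (hUs hvU) hne)) hα₀ _ hβ'
  · intro s hs hUs α hα hne
    have hvs : v ∈ s := hUs hvU
    obtain ⟨α₀, hα₀, hrun⟩ := key s hs hUs hα.1
    obtain ⟨hα', hdec'⟩ := hrun α hα.2
    have hα₁ := isSchedule_append.2 ⟨hα₀, hα'⟩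
    have hvd : ((init s).run (ids U :: α)).decision δ v.1 = some w :=
      run_decision_of_decision_eq_some (C := (init s).step (ids U)) hα.2 (hdec s)
    have hout : ∀ y ∈ ((init s).run (ids U :: α)).outputs δ, y = (v.1, w) ∨
        y ∈ ((init (s.erase v)).run (α₀ ++ α)).outputs δ' := by
      rintro ⟨q, y⟩ hy
      rw [mem_outputs] at hy
      by_cases hq : q = v.1
      · subst hq
        rw [hvd] at hy
        exact Or.inl (by simp [Option.some.inj hy])
      · rw [mem_outputs, run_append, hdec' q hq]
        exact Or.inr hy
    rcases (((init (s.erase v)).run (α₀ ++ α)).outputs δ').eq_empty_or_nonempty with he | hne'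
    · refine mem_of_mem_of_subset (T.carrier_mono _ hv s hs (by simpa) hl.2) ?_ hne
      intro y hy
      rcases hout y hy with hy | hy
      · simp [hy]
      · simp [he] at hy
    · have hse : (s.erase v).Nonempty := by
        by_contra hse
        have hse := Finset.not_nonempty_iff_eq_empty.1 hse
        obtain ⟨⟨q, y⟩, hy⟩ := hne'
        rw [hempty s _ hse hα₁, mem_outputs] at hy
        simp [decision, Config.run, init] at hy
      obtain ⟨⟨-, t, ht, hlt, hsub⟩, -⟩ :=
        hsol _ (erase_mem_link hs hvs hse) _ hα₁ hne'
      have hsu : s.erase v ∪ {v} = s := by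
        rw [Finset.union_comm, ← Finset.insert_eq, Finset.insert_erase hvs]
      have ht' : t ∈ T.carrier (s.erase v ∪ {v}) := ht.1
      rw [hsu] at ht'
      refine mem_of_mem_of_subset ht' (fun y hy => ?_) hne
      rcases hout y hy with rfl | hy
      · exact hlt (Finset.mem_singleton_self _)
      · exact hsub hy

end DecisionTask

end NIIS

theorem mainTheorem6 {n : ℕ} {V W : Type*} [DecidableEq V]
    (T : NIIS.DecisionTask (Fin (n + 1)) V W) (hT : NIIS.IsFull T.input) :
    ((∀ U ∈ T.input, T.HasPartialProtocol U) ↔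
      ∀ v : Fin (n + 1) × V, {v} ∈ T.input →
        ∃ l, T.IsLabel {v} l ∧ (T.linkTask {v} l).HasWaitFreeProtocol) ∧
    ((∀ U ∈ T.input, T.HasPartialProtocol U) ↔
      ∀ v : Fin (n + 1) × V, {v} ∈ T.input → T.HasPartialProtocol {v}) := by
  have vertex_to_link : (∀ v : Fin (n + 1) × V, {v} ∈ T.input → T.HasPartialProtocol {v}) →
      ∀ v : Fin (n + 1) × V, {v} ∈ T.input →
        ∃ l, T.IsLabel {v} l ∧ (T.linkTask {v} l).HasWaitFreeProtocol :=
    fun h v hv => (h v hv).exists_linkTask_hasWaitFreeProtocol hT hv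
  have link_to_simplex : (∀ v : Fin (n + 1) × V, {v} ∈ T.input →
        ∃ l, T.IsLabel {v} l ∧ (T.linkTask {v} l).HasWaitFreeProtocol) →
      ∀ U ∈ T.input, T.HasPartialProtocol U := by
    intro h U hU
    obtain ⟨v, hv⟩ := (T.input.isRelLowerSet_faces hU).1
    obtain ⟨l, hl, hlink⟩ := h v
      (NIIS.mem_of_mem_of_subset hU (by simpa using hv) (Finset.singleton_nonempty _))
    exact NIIS.DecisionTask.hasPartialProtocol_of_linkTask hU hv hl hlink
  exact ⟨⟨fun h => vertex_to_link fun v hv => h _ hv, link_to_simplex⟩,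
    ⟨fun h v hv => h _ hv, fun h => link_to_simplex (vertex_to_link h)⟩⟩
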